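/- Let $\lambda$-terms be taken up to renaming of bound variables, and let $\triangleright$ be the closure under all term contexts of the union of the rules - $\beta$: $(\lambda x.M\ N)\triangleright M[x:=N]$, - $\delta$: $(\lambda y.\lambda x.M\ N)\triangleright \lambda x.(\lambda y.M\ N)$ with $x$ not free in $N$, - $\gamma$: $(\lambda x.M\ N\ P)\triangleright(\lambda x.(M\ P)\ N)$ with $x$ not free in $P$, - assoc: $(M\ (\lambda x.N\ P))\triangleright(\lambda x.(M\ N)\ P)$ with $x$ not free in $M$, where application associates to the left and $(\lambda x.M\ N)$ denotes the abstraction $\lambda x.M$ applied to $N$. A term $t$ is in $SN$ if every sequence of $\triangleright$-reductions starting from $t$ is finite. Types are those of system $\mathcal D$ with no intersection at the right of an arrow: given a set $\mathcal A$ of atomic constants, $\mathcal S ::= \mathcal A\mid \mathcal T\to\mathcal S$ and $\mathcal T ::= \mathcal S\mid \mathcal S\wedge\mathcal T$. Judgements $\Gamma\vdash M:A$, where $\Gamma$ is a set of declarations $x:A$ with at most one for each variable, are derived by the axiom $\Gamma,x:A\vdash x:A$, introduction and elimination of $\to$, and introduction and (left and right) elimination of $\wedge$. **Theorem.** Let $t$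 be a term and let $\sigma$ be a (simultaneous, capture-avoiding) substitution with finite domain $\mathrm{dom}(\sigma)$. Let $A$ be a type that is assignable to $\sigma(x)$, in some context that may depend on $x$, for every $x\in\mathrm{dom}(\sigma)$ (that is, $\sigma$ is fair), and assume that $\Gamma\vdash t:B$ for some type $B$ and some context $\Gamma$ that declares $x:A$ for every $x\in\mathrm{dom}(\sigma)$. If $t\in SN$ and $\sigma(x)\in SN$ for every $x\in\mathrm{dom}(\sigma)$, then $\sigma(t)\in SN$. -/

import Mathlib

universe u

namespace SystemD

/-- Untyped lambda-terms up to renaming of bound variables, in de Bruijn notation: `var n` is a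
variable (free if it points outside all the enclosing abstractions), `lam M` is the abstraction
binding index `0` of `M`, and `app M N` is the application `(M N)`. -/
inductive Term : Type
  | var : ℕ → Term
  | lam : Term → Term
  | app : Term → Term → Term

namespace Term

/-- A renaming of free variables, pushed under one binder. -/
def liftRen (ρ : ℕ → ℕ) : ℕ → ℕ
  | 0 => 0
  | n + 1 => ρ n + 1

/-- Renaming of the free variables. -/
def rename : (ℕ → ℕ) → Term → Term
  | ρ, var n => var (ρ n)
  | ρ, lam M => lam (rename (liftRen ρ) M)
  | ρ, app M N => app (rename ρ M) (rename ρ N)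

/-- `M` seen under one additional binder, whose variable is not free in it. -/
def shift (M : Term) : Term := rename Nat.succ M

/-- A map from variables to terms, pushed under one binder. -/
def liftMap (f : ℕ → Term) : ℕ → Term
  | 0 => var 0
  | n + 1 => shift (f n)

/-- Simultaneous capture-avoiding substitution of `f n` for each free variable `n`. -/
def subst : (ℕ → Term) → Term → Term
  | f, var n => f n
  | f, lam M => lam (subst (liftMap f) M)
  | f, app M N => app (subst f M) (subst f N)

/-- `M[x := N]`, where `x` is the variable of index `0` of `M`, removed by the substitution. -/
def inst (M N : Term) : Term :=
  subst (fun n => match n with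
    | 0 => N
    | k + 1 => var k) M

/-- Exchange of the two innermost variables (indices `0` and `1`). -/
def swap01 (M : Term) : Term :=
  rename (fun n => match n with
    | 0 => 1
    | 1 => 0
    | k + 2 => k + 2) M

/-- One-step reduction: the closure under all term contexts of the union of the four rules.
The conditions that the bound variable `x` is not free in the term moved under its binder
(`N` in `delta`, `P` in `gamma`, `M` in `assoc`) are expressed by `shift`. -/
inductive Red : Term → Term → Prop
  /-- `(λx.M N) ▷ M[x := N]` -/
  | beta (M N : Term) : Red (app (lam M) N) (inst M N)
  /-- `(λy.λx.M N) ▷ λx.(λy.M N)`; in `M`, index `0` is `x` and index `1` is `y` on the left,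
  and the other way round on the right. -/
  | delta (M N : Term) :
      Red (app (lam (lam M)) N) (lam (app (lam (swap01 M)) (shift N)))
  /-- `(λx.M N P) ▷ (λx.(M P) N)` -/
  | gamma (M N P : Term) :
      Red (app (app (lam M) N) P) (app (lam (app M (shift P))) N)
  /-- `(M (λx.N P)) ▷ (λx.(M N) P)` -/
  | assoc (M N P : Term) :
      Red (app M (app (lam N) P)) (app (lam (app (shift M) N)) P)
  | lam {M M' : Term} : Red M M' → Red (lam M) (lam M')
  | appLeft {M M' : Term} (N : Term) : Red M M' → Red (app M N) (app M' N)
  | appRight (M : Term) {N N' : Term} : Red N N' → Red (app M N) (app M N')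

/-- `t` is strongly normalizing: every sequence of reductions starting from `t` is finite. -/
def SN (t : Term) : Prop :=
  ¬ ∃ s : ℕ → Term, s 0 = t ∧ ∀ n, Red (s n) (s (n + 1))

end Term

/-- A substitution: a finite domain and the value at each variable of the domain
(the values of `val` outside `dom` are irrelevant). -/
structure Subst where
  dom : Finset ℕ
  val : ℕ → Term

namespace Subst

/-- `σ(t)`: the free variables of `t` in the domain are replaced simultaneously by their values,
the other ones are kept. -/
def apply (σ : Subst) (t : Term) : Term :=
  t.subst (fun x => if x ∈ σ.dom then σ.val x else Term.var x)

/-- `σ ∈ SN`: each value on the domain is strongly normalizing. -/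
def SN (σ : Subst) : Prop := ∀ x ∈ σ.dom, (σ.val x).SN

end Subst

mutual
  /-- Simple types `S ::= 𝒜 | T → S` over the set `α` of atomic constants. -/
  inductive STy (α : Type u) : Type u
    | atom : α → STy α
    | arrow : Ty α → STy α → STy α
  /-- Types `T ::= S | S ∧ T` over the set `α` of atomic constants. -/
  inductive Ty (α : Type u) : Type u
    | simple : STy α → Ty α
    | inter : STy α → Ty α → Ty α
end

/-- A typing context: a set of declarations `x : A`, at most one for each variable. -/
abbrev Ctx (α : Type u) := ℕ → Option (Ty α)

/-- `Γ, x : A`, where `x` is the new variable of index `0`. -/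
def Ctx.cons {α : Type u} (A : Ty α) (Γ : Ctx α) : Ctx α
  | 0 => some A
  | n + 1 => Γ n

/-- `Typing Γ M A` is the judgement `Γ ⊢ M : A`. The grammar of types forces the right-hand side
of an arrow, and the left-hand side of an intersection, to be a simple type. -/
inductive Typing {α : Type u} : Ctx α → Term → Ty α → Prop
  | var {Γ : Ctx α} {x : ℕ} {A : Ty α} : Γ x = some A → Typing Γ (Term.var x) A
  | app {Γ : Ctx α} {M N : Term} {A : Ty α} {B : STy α} :
      Typing Γ M (Ty.simple (STy.arrow A B)) → Typing Γ N A →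
      Typing Γ (Term.app M N) (Ty.simple B)
  | lam {Γ : Ctx α} {M : Term} {A : Ty α} {B : STy α} :
      Typing (Ctx.cons A Γ) M (Ty.simple B) →
      Typing Γ (Term.lam M) (Ty.simple (STy.arrow A B))
  | interLeft {Γ : Ctx α} {M : Term} {A : STy α} {B : Ty α} :
      Typing Γ M (Ty.inter A B) → Typing Γ M (Ty.simple A)
  | interRight {Γ : Ctx α} {M : Term} {A : STy α} {B : Ty α} :
      Typing Γ M (Ty.inter A B) → Typing Γ M B
  | interIntro {Γ : Ctx α} {M : Term} {A : STy α} {B : Ty α} :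
      Typing Γ M (Ty.simple A) → Typing Γ M B → Typing Γ M (Ty.inter A B)

/-- The type `A` is assignable to `M` (in some context). -/
def Assignable {α : Type u} (M : Term) (A : Ty α) : Prop := ∃ Γ : Ctx α, Typing Γ M A

/-- `σ` is fair with `type(σ) = A`: its values on its domain all have the type `A`. -/
def Subst.FairOfType {α : Type u} (σ : Subst) (A : Ty α) : Prop :=
  ∀ x ∈ σ.dom, Assignable (σ.val x) A

end SystemD

-- Strong normalization is read off from non-idempotent intersection types in which every argument
-- carries at least one type. A derivation bounds the number of its application rules. Each β step,
-- wherever it occurs, lowers this bound, because no part of the derivation is duplicated and no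
-- subterm is left untyped. The rules δ, γ and assoc do not raise the bound and lower an arithmetic
-- weight. So the pair (bound, weight) decreases lexicographically (`Derives.red`, `Derives.sn`).
--
-- It remains to give `σ(t)` a quantitative type. This is a reducibility argument over the types of
-- system D, with atoms interpreted as quantitative typability. The permutation rules play no role
-- in it: it only needs β-expansion (`HasQTy.app_lam`), which follows from anti-substitution
-- (`Derives.of_subst`). The fundamental lemma `Typing.reducible` then applies to the values of `σ`
-- and to `t`.

namespace SystemD

/-! ### Quantitative (non-idempotent) intersection types -/

/-- Non-idempotent intersection types: `arrow l A` expects an argument having, once for each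
occurrence, every type of the list `l`. -/
inductive QTy : Type
  | atom : QTy
  | arrow : List QTy → QTy → QTy

/-- A resource: for each variable the multiset of types at which it may be used,
and a bound on the number of application rules. -/
abbrev Res := (ℕ → Multiset QTy) × ℕ

-- Arithmetic of resources

namespace Res

/-- Add a variable of index `0`, with the types `s`. -/
def push (s : Multiset QTy) (r : Res) : Res :=
  (fun x => match x with
    | 0 => s
    | n + 1 => r.1 n, r.2)

/-- Permission to use `k` application rules. -/
def tick (k : ℕ) : Res := (0, k)

/-- Restriction of the context along a renaming. -/
def comap (ρ : ℕ → ℕ) (r : Res) : Res := (r.1 ∘ ρ, r.2)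

/-- Extension of the context along a renaming. -/
noncomputable def ext (ρ : ℕ → ℕ) (r : Res) : Res := (Function.extend ρ r.1 0, r.2)

theorem push_le_push {s t : Multiset QTy} {r q : Res} (h : s ≤ t) (h' : r ≤ q) :
    push s r ≤ push t q := by
  refine ⟨fun x => ?_, h'.2⟩
  cases x with
  | zero => exact h
  | succ n => exact h'.1 n

theorem push_add (s t : Multiset QTy) (r q : Res) :
    push s r + push t q = push (s + t) (r + q) := by
  refine Prod.ext (funext fun x => ?_) rfl
  cases x <;> rfl

theorem push_zero_tick (k : ℕ) : push 0 (tick k) = tick k := by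
  refine Prod.ext (funext fun x => ?_) rfl
  cases x <;> rfl

theorem comap_add (ρ : ℕ → ℕ) (r q : Res) : comap ρ (r + q) = comap ρ r + comap ρ q := rfl

theorem comap_tick (ρ : ℕ → ℕ) (k : ℕ) : comap ρ (tick k) = tick k := rfl

theorem comap_mono (ρ : ℕ → ℕ) {r q : Res} (h : r ≤ q) : comap ρ r ≤ comap ρ q :=
  ⟨fun x => h.1 (ρ x), h.2⟩

theorem push_comap_succ (r : Res) : push (r.1 0) (comap Nat.succ r) = r := by
  refine Prod.ext (funext fun x => ?_) rfl
  cases x <;> rfl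

theorem comap_liftRen_push (ρ : ℕ → ℕ) (s : Multiset QTy) (r : Res) :
    comap (Term.liftRen ρ) (push s r) = push s (comap ρ r) := by
  refine Prod.ext (funext fun x => ?_) rfl
  cases x <;> rfl

theorem comap_ext {ρ : ℕ → ℕ} (hρ : ρ.Injective) (r : Res) : comap ρ (ext ρ r) = r :=
  Prod.ext (funext fun x => hρ.extend_apply r.1 0 x) rfl

theorem ext_tick (ρ : ℕ → ℕ) (k : ℕ) : ext ρ (tick k) = tick k := by
  refine Prod.ext (funext fun x => ?_) rfl
  classical
  simp only [ext, tick, Function.extend_def]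
  split <;> rfl

theorem ext_add (ρ : ℕ → ℕ) (r q : Res) : ext ρ (r + q) = ext ρ r + ext ρ q := by
  refine Prod.ext (funext fun x => ?_) rfl
  classical
  simp only [ext, Prod.fst_add, Pi.add_apply, Function.extend_def]
  split
  · rfl
  · simp

theorem ext_mono (ρ : ℕ → ℕ) {r q : Res} (h : r ≤ q) : ext ρ r ≤ ext ρ q := by
  refine ⟨fun x => ?_, h.2⟩
  classical
  simp only [ext, Function.extend_def]
  split
  · exact h.1 _
  · exact le_rfl

theorem ext_comap_le {ρ : ℕ → ℕ} (hρ : ρ.Injective) (r : Res) : ext ρ (comap ρ r) ≤ r := by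
  refine ⟨fun x => ?_, le_rfl⟩
  by_cases hx : ∃ y, ρ y = x
  · obtain ⟨y, rfl⟩ := hx
    exact (hρ.extend_apply (r.1 ∘ ρ) 0 y).le
  · exact (Function.extend_apply' (r.1 ∘ ρ) (0 : ℕ → Multiset QTy) x hx).le.trans
      (Multiset.zero_le _)

end Res

namespace Term

theorem liftRen_injective {ρ : ℕ → ℕ} (hρ : ρ.Injective) : (liftRen ρ).Injective := by
  intro a b h
  cases a <;> cases b <;> simp_all [liftRen]
  exact hρ h

end Term

namespace Res

theorem ext_liftRen_push {ρ : ℕ → ℕ} (hρ : ρ.Injective) (s : Multiset QTy) (r : Res) :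
    ext (Term.liftRen ρ) (push s r) ≤ push s (ext ρ r) := by
  have h : push s r = comap (Term.liftRen ρ) (push s (ext ρ r)) := by
    rw [comap_liftRen_push, comap_ext hρ]
  rw [h]
  exact ext_comap_le (Term.liftRen_injective hρ) _

end Res

-- Splitting a resource, and quantitative typing

open Res

/-- `All P r s`: the resource `r` can be split so as to satisfy `P` for each type of `s`. -/
inductive All (P : Res → QTy → Prop) : Res → Multiset QTy → Prop
  | zero (r : Res) : All P r 0
  | cons {r₁ r₂ r : Res} {A : QTy} {s : Multiset QTy} :
      P r₁ A → All P r₂ s → r₁ + r₂ ≤ r → All P r (A ::ₘ s)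

namespace All

variable {P Q : Res → QTy → Prop} {r r' r₁ r₂ : Res} {s s₁ s₂ : Multiset QTy} {A : QTy}

theorem mono (h : All P r s) (hr : r ≤ r') : All P r' s := by
  cases h with
  | zero => exact .zero _
  | cons hA hs hle => exact .cons hA hs (hle.trans hr)

theorem map (g : Res → Res) (hadd : ∀ a b, g (a + b) = g a + g b)
    (hmono : ∀ a b, a ≤ b → g a ≤ g b) (hPQ : ∀ r A, P r A → Q (g r) A) (h : All P r s) :
    All Q (g r) s := by
  induction h with
  | zero => exact .zero _
  | cons hA _ hle ih => exact .cons (hPQ _ _ hA) ih ((hadd _ _).symm.le.trans (hmono _ _ hle))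

theorem add (h₁ : All P r₁ s₁) (h₂ : All P r₂ s₂) : All P (r₁ + r₂) (s₁ + s₂) := by
  induction h₁ with
  | zero r => simpa using h₂.mono (le_add_of_nonneg_left (by simp))
  | cons hA _ hle ih =>
    rw [Multiset.cons_add]
    exact .cons hA ih (by rw [← add_assoc]; gcongr)

theorem single (h : P r A) : All P r {A} :=
  .cons h (.zero 0) (by simp)

theorem split (h : All P r (s₁ + s₂)) : ∃ r₁ r₂, r₁ + r₂ ≤ r ∧ All P r₁ s₁ ∧ All P r₂ s₂ := by
  generalize hs : s₁ + s₂ = s at h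
  induction h generalizing s₁ s₂ with
  | zero r =>
    obtain ⟨rfl, rfl⟩ := add_eq_zero.mp hs
    exact ⟨0, 0, by simp, .zero _, .zero _⟩
  | @cons q₁ q₂ q A s hA _ hle ih =>
    have hmem : A ∈ s₁ + s₂ := hs ▸ Multiset.mem_cons_self A s
    rcases Multiset.mem_add.mp hmem with hm | hm
    · obtain ⟨t, rfl⟩ := Multiset.exists_cons_of_mem hm
      rw [Multiset.cons_add] at hs
      obtain ⟨a, b, hab, ha, hb⟩ := ih ((Multiset.cons_inj_right A).mp hs)
      exact ⟨q₁ + a, b, by rw [add_assoc]; exact (add_le_add_right hab _).trans hle,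
        .cons hA ha le_rfl, hb⟩
    · obtain ⟨t, rfl⟩ := Multiset.exists_cons_of_mem hm
      rw [Multiset.add_cons] at hs
      obtain ⟨a, b, hab, ha, hb⟩ := ih ((Multiset.cons_inj_right A).mp hs)
      exact ⟨a, q₁ + b, by rw [add_left_comm]; exact (add_le_add_right hab _).trans hle,
        ha, .cons hA hb le_rfl⟩

theorem of_singleton (hP : ∀ r r' A, r ≤ r' → P r A → P r' A) (h : All P r {A}) : P r A := by
  generalize hs : ({A} : Multiset QTy) = s at h
  cases h with
  | zero => simp at hs
  | cons hA _ hle =>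
    have h1 := Multiset.cons_eq_cons.mp ((Multiset.cons_zero A).trans hs)
    rcases h1 with ⟨rfl, _⟩ | ⟨_, _, h0, _⟩
    · exact hP _ _ _ ((le_add_of_nonneg_right (by simp)).trans hle) hA
    · simp at h0

theorem anti (h : All P r s₂) (hs : s₁ ≤ s₂) : All P r s₁ := by
  obtain ⟨t, rfl⟩ := Multiset.le_iff_exists_add.mp hs
  obtain ⟨a, b, hab, ha, -⟩ := h.split
  exact ha.mono ((le_add_of_nonneg_right (by simp)).trans hab)

theorem of_mem (hP : ∀ r r' A, r ≤ r' → P r A → P r' A) (h : All P r s) (hA : A ∈ s) : P r A :=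
  of_singleton hP (h.anti (Multiset.singleton_le.mpr hA))

end All

/-- Quantitative typing: `M` has the type `A`, using at most the resource `r`. -/
def Derives : Term → Res → QTy → Prop
  | .var x, r, A => A ∈ r.1 x
  | .lam M, r, A => ∃ (l : List QTy) (B : QTy), l ≠ [] ∧ A = .arrow l B ∧
      Derives M (push (l : Multiset QTy) r) B
  | .app M N, r, B => ∃ (l : List QTy) (r₁ r₂ : Res), l ≠ [] ∧ r₁ + r₂ + tick 1 ≤ r ∧
      Derives M r₁ (.arrow l B) ∧ All (Derives N) r₂ (l : Multiset QTy)

theorem Derives.mono {M : Term} {r r' : Res} {A : QTy} (hr : r ≤ r') (h : Derives M r A) :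
    Derives M r' A := by
  induction M generalizing r r' A with
  | var x => exact Multiset.mem_of_le (hr.1 x) h
  | lam M ih =>
    obtain ⟨l, B, hl, rfl, h⟩ := h
    exact ⟨l, B, hl, rfl, ih (push_le_push le_rfl hr) h⟩
  | app M N _ _ =>
    obtain ⟨l, r₁, r₂, hl, hle, h⟩ := h
    exact ⟨l, r₁, r₂, hl, hle.trans hr, h⟩

theorem Derives.of_rename {M : Term} {ρ : ℕ → ℕ} {r : Res} {A : QTy}
    (h : Derives (M.rename ρ) r A) : Derives M (comap ρ r) A := by
  induction M generalizing ρ r A with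
  | var x => exact h
  | lam M ih =>
    obtain ⟨l, B, hl, rfl, h⟩ := h
    exact ⟨l, B, hl, rfl, comap_liftRen_push ρ _ r ▸ ih h⟩
  | app M N ihM ihN =>
    obtain ⟨l, r₁, r₂, hl, hle, hM, hN⟩ := h
    exact ⟨l, comap ρ r₁, comap ρ r₂, hl, comap_mono ρ hle, ihM hM,
      hN.map (comap ρ) (comap_add ρ) (fun _ _ => comap_mono ρ) fun _ _ => ihN⟩

/-- An application splits the resource of `M`, and the parts must be carried forward along `ρ`;
hence `ext`. The form with `comap` follows by weakening. -/
theorem Derives.rename_ext {M : Term} {ρ : ℕ → ℕ} (hρ : ρ.Injective) {r : Res} {A : QTy}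
    (h : Derives M r A) : Derives (M.rename ρ) (ext ρ r) A := by
  induction M generalizing ρ r A with
  | var x =>
    change A ∈ (comap ρ (ext ρ r)).1 x
    rwa [comap_ext hρ]
  | lam M ih =>
    obtain ⟨l, B, hl, rfl, h⟩ := h
    exact ⟨l, B, hl, rfl, (ih (Term.liftRen_injective hρ) h).mono (ext_liftRen_push hρ _ r)⟩
  | app M N ihM ihN =>
    obtain ⟨l, r₁, r₂, hl, hle, hM, hN⟩ := h
    refine ⟨l, ext ρ r₁, ext ρ r₂, hl, ?_, ihM hρ hM,
      hN.map (ext ρ) (ext_add ρ) (fun _ _ => ext_mono ρ) fun _ _ => ihN hρ⟩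
    rw [← ext_add, ← ext_tick ρ 1, ← ext_add]
    exact ext_mono ρ hle

theorem Derives.rename {M : Term} {ρ : ℕ → ℕ} (hρ : ρ.Injective) {r : Res} {A : QTy}
    (h : Derives M (comap ρ r) A) : Derives (M.rename ρ) r A :=
  (h.rename_ext hρ).mono (ext_comap_le hρ r)

theorem Derives.shift {M : Term} {r : Res} {A : QTy} (h : Derives M r A) :
    Derives M.shift (push 0 r) A :=
  Derives.rename Nat.succ_injective h

theorem All.shift {M : Term} {r : Res} {s : Multiset QTy} (h : All (Derives M) r s) :
    All (Derives M.shift) (push 0 r) s :=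
  h.map (push 0) (fun a b => by rw [push_add, add_zero]) (fun _ _ => push_le_push le_rfl)
    fun _ _ => Derives.shift

/-! ### Substitution and anti-substitution -/

/-- `f` replaces the variable `k` by `N`, and renames the other variables by the inverse
of `ρ`. -/
structure Replaces (f : ℕ → Term) (k : ℕ) (ρ : ℕ → ℕ) (N : Term) : Prop where
  self : f k = N
  other : ∀ x, f (ρ x) = .var x
  cover : ∀ x, x = k ∨ ∃ y, x = ρ y
  inj : ρ.Injective
  ne : ∀ x, ρ x ≠ k

theorem Replaces.lift {f : ℕ → Term} {k : ℕ} {ρ : ℕ → ℕ} {N : Term} (h : Replaces f k ρ N) :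
    Replaces (Term.liftMap f) (k + 1) (Term.liftRen ρ) N.shift where
  self := congrArg Term.shift h.self
  other x := by
    cases x with
    | zero => rfl
    | succ x => exact congrArg Term.shift (h.other x)
  cover x := by
    cases x with
    | zero => exact .inr ⟨0, rfl⟩
    | succ x =>
      rcases h.cover x with rfl | ⟨y, rfl⟩
      · exact .inl rfl
      · exact .inr ⟨y + 1, rfl⟩
  inj := Term.liftRen_injective h.inj
  ne x := by
    cases x with
    | zero => exact Nat.zero_ne_add_one k
    | succ x => exact fun e => h.ne x (Nat.succ_injective e)

theorem Replaces.inst (N : Term) : Replaces (fun n => match n with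
    | 0 => N
    | k + 1 => .var k) 0 Nat.succ N where
  self := rfl
  other _ := rfl
  cover x := by cases x <;> simp
  inj := Nat.succ_injective
  ne := Nat.succ_ne_zero

theorem All.substitute {P Q : Res → QTy → Prop} {N : Term} {k : ℕ} {ρ : ℕ → ℕ}
    (hPQ : ∀ r q A, P r A → All (Derives N) q (r.1 k) → Q (comap ρ r + q) A)
    {r q : Res} {s : Multiset QTy} (h : All P r s) (hq : All (Derives N) q (r.1 k)) :
    All Q (comap ρ r + q) s := by
  induction h generalizing q with
  | zero => exact .zero _
  | @cons r₁ r₂ r A s hA _ hle ih =>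
    obtain ⟨q₁, q₂, hq', h₁, h₂⟩ := (hq.anti (hle.1 k)).split
    refine .cons (hPQ _ _ _ hA h₁) (ih h₂) ?_
    rw [add_add_add_comm, ← comap_add]
    exact add_le_add (comap_mono ρ hle) hq'

/-- Each typed use of `k` consumes its own derivation of `N`, so the costs simply add up. -/
theorem Derives.subst {M N : Term} {f : ℕ → Term} {k : ℕ} {ρ : ℕ → ℕ} (hf : Replaces f k ρ N)
    {r q : Res} {A : QTy} (h : Derives M r A) (hq : All (Derives N) q (r.1 k)) :
    Derives (M.subst f) (comap ρ r + q) A := by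
  induction M generalizing f k ρ N r q A with
  | var x =>
    rcases hf.cover x with rfl | ⟨y, rfl⟩
    · change Derives (f x) _ A
      rw [hf.self]
      exact (All.of_mem (P := Derives N) (fun _ _ _ hr => Derives.mono hr) hq h).mono
        (le_add_of_nonneg_left (by simp))
    · change Derives (f (ρ y)) _ A
      rw [hf.other]
      exact Multiset.mem_add.mpr (.inl h)
  | lam M ih =>
    obtain ⟨l, B, hl, rfl, h⟩ := h
    refine ⟨l, B, hl, rfl, ?_⟩
    have := ih hf.lift h hq.shift
    rwa [comap_liftRen_push, push_add, add_zero] at this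
  | app M N' ihM ihN =>
    obtain ⟨l, r₁, r₂, hl, hle, hM, hN⟩ := h
    have hle' : r₁.1 k + r₂.1 k ≤ r.1 k := by simpa [tick] using hle.1 k
    obtain ⟨q₁, q₂, hq', h₁, h₂⟩ := (hq.anti hle').split
    refine ⟨l, _, _, hl, ?_, ihM hf hM h₁,
      hN.substitute (fun _ _ _ hA hr => ihN hf hA hr) h₂⟩
    rw [add_add_add_comm, ← comap_add, add_right_comm, ← comap_tick ρ 1, ← comap_add]
    exact add_le_add (comap_mono ρ hle) hq'

theorem All.of_substitute {P Q : Res → QTy → Prop} {N : Term} {k : ℕ} {ρ : ℕ → ℕ}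
    (hPQ : ∀ r A, Q r A → ∃ r' q, comap ρ r' + q ≤ r ∧ P r' A ∧ All (Derives N) q (r'.1 k))
    {r : Res} {s : Multiset QTy} (h : All Q r s) :
    ∃ r' q, comap ρ r' + q ≤ r ∧ All P r' s ∧ All (Derives N) q (r'.1 k) := by
  induction h with
  | zero r => exact ⟨0, 0, by change (0 : Res) + 0 ≤ r; simp, .zero _, .zero _⟩
  | cons hA _ hle ih =>
    obtain ⟨a, b, hab, ha, hb⟩ := ih
    obtain ⟨c, d, hcd, hc, hd⟩ := hPQ _ _ hA
    refine ⟨c + a, d + b, ?_, .cons hc ha le_rfl, hd.add hb⟩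
    rw [comap_add, add_add_add_comm]
    exact (add_le_add hcd hab).trans hle

/-- The multiset at `k` collects the types at which the copies of `N` are used; it is empty if there
is no copy. -/
theorem Derives.of_subst {M N : Term} {f : ℕ → Term} {k : ℕ} {ρ : ℕ → ℕ}
    (hf : Replaces f k ρ N) {r : Res} {A : QTy} (h : Derives (M.subst f) r A) :
    ∃ r' q, comap ρ r' + q ≤ r ∧ Derives M r' A ∧ All (Derives N) q (r'.1 k) := by
  induction M generalizing f k ρ N r A with
  | var x =>
    change Derives (f x) r A at h
    rcases hf.cover x with rfl | ⟨y, rfl⟩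
    · rw [hf.self] at h
      -- The variable costs one use at `A` and no application; all of `r` goes to `N`.
      refine ⟨(Pi.single x {A}, 0), r, ?_, ?_, ?_⟩
      · have : comap ρ (Pi.single x {A}, 0) = 0 := by
          refine Prod.ext (funext fun y => ?_) rfl
          exact Pi.single_eq_of_ne (hf.ne y) _
        rw [this, zero_add]
      · change A ∈ (Pi.single x {A} : ℕ → Multiset QTy) x
        simp
      · simpa using All.single h
    · rw [hf.other] at h
      refine ⟨ext ρ r, 0, ?_, ?_, ?_⟩
      · rw [comap_ext hf.inj, add_zero]
      · change A ∈ (comap ρ (ext ρ r)).1 y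
        rwa [comap_ext hf.inj]
      · have : (ext ρ r).1 k = 0 :=
          Function.extend_apply' r.1 (0 : ℕ → Multiset QTy) k fun ⟨y, hy⟩ => hf.ne y hy
        rw [this]
        exact .zero _
  | lam M ih =>
    obtain ⟨l, B, hl, rfl, h⟩ := h
    obtain ⟨r', q, hle, hM, hq⟩ := ih hf.lift h
    -- The shifted `N` does not use index `0`, so that entry of `q` can be dropped.
    refine ⟨comap Nat.succ r', comap Nat.succ q, ?_, ⟨l, B, hl, rfl, ?_⟩, ?_⟩
    · exact comap_mono Nat.succ hle
    · refine hM.mono ?_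
      rw [← push_comap_succ r']
      refine push_le_push ?_ le_rfl
      exact (le_add_of_nonneg_right (Multiset.zero_le _)).trans (hle.1 0)
    · exact hq.map (comap Nat.succ) (comap_add _) (fun _ _ => comap_mono _)
        fun _ _ => Derives.of_rename
  | app M N' ihM ihN =>
    obtain ⟨l, r₁, r₂, hl, hle, hM, hN⟩ := h
    obtain ⟨a, b, hab, ha, hb⟩ := ihM hf hM
    obtain ⟨c, d, hcd, hc, hd⟩ := hN.of_substitute fun _ _ hA => ihN hf hA
    refine ⟨a + c + tick 1, b + d, ?_, ⟨l, a, c, hl, le_rfl, ha, hc⟩, ?_⟩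
    · rw [comap_add, comap_add, comap_tick, add_right_comm, add_add_add_comm]
      exact (add_le_add_left (add_le_add hab hcd) _).trans hle
    · simpa [tick] using hb.add hd

/-! ### Subject reduction -/

theorem Derives.beta {M N : Term} {r : Res} {A : QTy} (h : Derives (.app (.lam M) N) r A) :
    ∃ q, q + tick 1 ≤ r ∧ Derives (M.inst N) q A := by
  obtain ⟨l, r₁, r₂, -, hle, ⟨l', B, -, e, hM⟩, hN⟩ := h
  cases e
  exact ⟨r₁ + r₂, hle, hM.subst (Replaces.inst N) hN⟩

theorem Derives.delta {M N : Term} {r : Res} {A : QTy}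
    (h : Derives (.app (.lam (.lam M)) N) r A) :
    Derives (.lam (.app (.lam M.swap01) N.shift)) r A := by
  obtain ⟨l, r₁, r₂, hl, hle, ⟨_, _, -, e, l', C, hl', e', hM⟩, hN⟩ := h
  cases e
  subst e'
  refine ⟨l', C, hl', rfl, l, push l' r₁, push 0 r₂, hl, ?_, ⟨l, C, hl, rfl, ?_⟩, hN.shift⟩
  · rw [← push_zero_tick 1, push_add, push_add, add_zero, add_zero]
    exact push_le_push le_rfl hle
  · refine Derives.rename ?_ ?_
    · rintro (_ | _ | a) (_ | _ | b) e <;> simp_all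
    · convert hM using 1
      refine Prod.ext (funext fun x => ?_) rfl
      rcases x with _ | _ | x <;> rfl

/-- The same two application rules are regrouped, so the bound does not change. -/
theorem Derives.gamma {M N P : Term} {r : Res} {A : QTy}
    (h : Derives (.app (.app (.lam M) N) P) r A) :
    Derives (.app (.lam (.app M P.shift)) N) r A := by
  obtain ⟨l, r₁, r₂, hl, hle, ⟨l', q₁, q₂, hl', hle', ⟨_, _, -, e, hM⟩, hN⟩, hP⟩ := h
  cases e
  refine ⟨l', q₁ + r₂ + tick 1, q₂, hl', ?_, ⟨l', A, hl', rfl, l, push l' q₁, push 0 r₂, hl,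
    ?_, hM, hP.shift⟩, hN⟩
  · refine le_trans (le_of_eq ?_) ((add_le_add_left (add_le_add_left hle' r₂) _).trans hle)
    abel
  · rw [← push_zero_tick 1, push_add, push_add, add_zero, add_zero, push_zero_tick]

/-- The redex is typed once per element of `s`. Its argument lists are merged into `t`, so that
assoc can pull out a single abstraction. -/
theorem All.app_lam {N P : Term} {r : Res} {s : Multiset QTy}
    (h : All (Derives (.app (.lam N) P)) r s) :
    ∃ (t : Multiset QTy) (r₁ r₂ : Res), (s ≠ 0 → t ≠ 0) ∧ r₁ + r₂ + tick s.card ≤ r ∧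
      All (Derives N) (push t r₁) s ∧ All (Derives P) r₂ t := by
  induction h with
  | zero r => exact ⟨0, 0, 0, fun h => h, by change (0 : Res) + 0 + 0 ≤ r; simp, .zero _, .zero _⟩
  | @cons q₁ q₂ q A s hA _ hle ih =>
    obtain ⟨t, r₁, r₂, -, hle₁, h₁, h₂⟩ := ih
    obtain ⟨l, a, b, hl, hle₂, ⟨_, _, -, e, hN⟩, hP⟩ := hA
    cases e
    refine ⟨l + t, a + r₁, b + r₂, ?_, ?_, .cons hN h₁ (push_add _ _ _ _).le, hP.add h₂⟩
    · simp [hl]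
    · refine le_trans (le_of_eq ?_) ((add_le_add hle₂ hle₁).trans hle)
      have : tick (A ::ₘ s).card = tick 1 + tick s.card := by
        rw [Multiset.card_cons, add_comm]
        exact Prod.ext (add_zero _).symm rfl
      rw [this]
      abel

theorem Derives.assoc {M N P : Term} {r : Res} {A : QTy}
    (h : Derives (.app M (.app (.lam N) P)) r A) :
    Derives (.app (.lam (.app M.shift N)) P) r A := by
  obtain ⟨l, r₁, r₂, hl, hle, hM, hN⟩ := h
  obtain ⟨t, q₁, q₂, ht, hle', hN, hP⟩ := hN.app_lam
  obtain ⟨t, rfl⟩ := Quot.exists_rep t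
  have ht' : t ≠ [] := by
    rintro rfl
    exact ht (by simpa using hl) rfl
  refine ⟨t, r₁ + q₁ + tick 1, q₂, ht', ?_, ⟨t, A, ht', rfl, l, push 0 r₁, push t q₁, hl, ?_,
    hM.shift, hN⟩, hP⟩
  -- The copies of the redex paid one application each; the single outer redex pays only one, and
  -- `l` is nonempty.
  · have h1 : tick 1 ≤ tick (l : Multiset QTy).card :=
      ⟨le_rfl, List.length_pos_iff.mpr hl⟩
    refine le_trans (le_of_eq ?_) ((add_le_add_left (add_le_add_right
      ((add_le_add_right h1 _).trans hle') r₁) _).trans hle)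
    abel
  · rw [← push_zero_tick 1, push_add, push_add, zero_add, add_zero, push_zero_tick]

/-! ### Strong normalization of the terms with a quantitative type -/

/-- A weight that decreases with each permutation rule. -/
def weight : Term → ℕ
  | .var _ => 2
  | .lam M => weight M + 1
  | .app M N => weight M * weight N

/-- This makes the permutations strict: with weights m, n, p of `M`, `N`, `P`, the drops are n - 1
for δ, n(p - 1) for γ and p(m - 1) for assoc. -/
theorem two_le_weight (M : Term) : 2 ≤ weight M := by
  induction M with
  | var => exact le_rfl
  | lam M ih => exact ih.trans (Nat.le_succ _)
  | app M N ihM ihN => exact ihM.trans (Nat.le_mul_of_pos_right _ (by omega))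

theorem weight_rename (ρ : ℕ → ℕ) (M : Term) : weight (M.rename ρ) = weight M := by
  induction M generalizing ρ with
  | var => rfl
  | lam M ih => simp [Term.rename, weight, ih]
  | app M N ihM ihN => simp [Term.rename, weight, ihM, ihN]

/-- A reduction step preserves the quantitative types, and either a unit of the bound is
spent or the weight of the term decreases. -/
theorem Derives.red {M M' : Term} (h : M.Red M') :
    (∀ r A, Derives M r A → ∃ q, q + tick 1 ≤ r ∧ Derives M' q A) ∨
      (weight M' < weight M ∧ ∀ r A, Derives M r A → Derives M' r A) := by
  induction h with
  | beta M N => exact .inl fun r A => Derives.beta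
  | delta M N =>
    refine .inr ⟨?_, fun r A => Derives.delta⟩
    have := two_le_weight N
    simp only [weight, Term.swap01, Term.shift, weight_rename]
    nlinarith
  | gamma M N P =>
    refine .inr ⟨?_, fun r A => Derives.gamma⟩
    have := two_le_weight N
    have := two_le_weight P
    simp only [weight, Term.shift, weight_rename]
    nlinarith
  | assoc M N P =>
    refine .inr ⟨?_, fun r A => Derives.assoc⟩
    have := two_le_weight M
    have := two_le_weight P
    simp only [weight, Term.shift, weight_rename]
    nlinarith
  | @lam M M' _ ih =>
    refine ih.imp (fun ih => ?_) fun ih => ⟨Nat.succ_lt_succ ih.1, ?_⟩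
    · rintro r _ ⟨l, B, hl, rfl, h⟩
      obtain ⟨q, hq, h⟩ := ih _ _ h
      refine ⟨comap Nat.succ q, comap_mono Nat.succ hq, l, B, hl, rfl, h.mono ?_⟩
      rw [← push_comap_succ q]
      exact push_le_push ((le_add_of_nonneg_right (Multiset.zero_le _)).trans (hq.1 0)) le_rfl
    · rintro r _ ⟨l, B, hl, rfl, h⟩
      exact ⟨l, B, hl, rfl, ih.2 _ _ h⟩
  | @appLeft M M' N _ ih =>
    refine ih.imp (fun ih => ?_) fun ih => ⟨?_, ?_⟩
    · rintro r A ⟨l, r₁, r₂, hl, hle, hM, hN⟩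
      obtain ⟨q, hq, h⟩ := ih _ _ hM
      refine ⟨q + r₂ + tick 1, ?_, l, q, r₂, hl, le_rfl, h, hN⟩
      refine le_trans (le_of_eq ?_) ((add_le_add_left (add_le_add_left hq r₂) _).trans hle)
      abel
    · have := two_le_weight N
      exact Nat.mul_lt_mul_of_pos_right ih.1 (by omega)
    · rintro r A ⟨l, r₁, r₂, hl, hle, hM, hN⟩
      exact ⟨l, r₁, r₂, hl, hle, ih.2 _ _ hM, hN⟩
  | @appRight M N N' _ ih =>
    refine ih.imp (fun ih => ?_) fun ih => ⟨?_, ?_⟩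
    -- One typed copy of the argument spends the unit, the others just keep their types; this is
    -- where nonempty lists matter.
    · have key : ∀ r s, All (Derives N) r s → s ≠ 0 →
          ∃ q, q + tick 1 ≤ r ∧ All (Derives N') q s := by
        have weak : ∀ r A, Derives N r A → Derives N' r A := fun r A h =>
          have ⟨q, hq, h⟩ := ih r A h
          h.mono ((le_add_of_nonneg_right (by simp)).trans hq)
        intro r s h hs
        cases h with
        | zero => exact absurd rfl hs
        | @cons r₁ r₂ _ _ _ hA h hle =>
          obtain ⟨q, hq, hA⟩ := ih _ _ hA
          refine ⟨q + r₂, ?_, .cons hA (h.map id (fun _ _ => rfl) (fun _ _ => id) weak) le_rfl⟩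
          rw [add_right_comm]
          exact (add_le_add_left hq _).trans hle
      rintro r A ⟨l, r₁, r₂, hl, hle, hM, hN⟩
      obtain ⟨q, hq, h⟩ := key _ _ hN (by simpa using hl)
      refine ⟨r₁ + q + tick 1, ?_, l, r₁, q, hl, le_rfl, hM, h⟩
      refine le_trans (le_of_eq ?_) ((add_le_add_left (add_le_add_right hq r₁) _).trans hle)
      abel
    · have := two_le_weight M
      exact Nat.mul_lt_mul_of_pos_left ih.1 (by omega)
    · rintro r A ⟨l, r₁, r₂, hl, hle, hM, hN⟩
      exact ⟨l, r₁, r₂, hl, hle, hM, hN.map id (fun _ _ => rfl) (fun _ _ => id) ih.2⟩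

/-- The bound comes first in the lexicographic order, since β may increase the weight. -/
theorem Derives.sn {M : Term} {r : Res} {A : QTy} (h : Derives M r A) : M.SN := by
  generalize hp : toLex (r.2, weight M) = p
  induction p using WellFoundedLT.induction generalizing M r with
  | ind p ih =>
    subst hp
    rintro ⟨s, rfl, hs⟩
    have next : ∀ q, Derives (s 1) q A →
        toLex (q.2, weight (s 1)) < toLex (r.2, weight (s 0)) → False := fun q hq hlt =>
      ih _ hlt hq rfl ⟨fun n => s (n + 1), rfl, fun n => hs (n + 1)⟩
    rcases Derives.red (hs 0) with h' | ⟨hw, h'⟩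
    · obtain ⟨q, hle, hq⟩ := h' _ _ h
      exact next q hq (Prod.Lex.toLex_lt_toLex.mpr (.inl (Nat.lt_of_succ_le hle.2)))
    · exact next r (h' _ _ h) (Prod.Lex.toLex_lt_toLex.mpr (.inr ⟨rfl, hw⟩))

/-! ### Reducibility for system `D` -/

/-- `M` has the quantitative type `A`, for some resource. -/
def HasQTy (M : Term) (A : QTy) : Prop := ∃ r, Derives M r A

/-- `M` has some quantitative type. -/
def QTypable (M : Term) : Prop := ∃ A, HasQTy M A

theorem QTypable.exists_all {N : Term} (h : QTypable N) :
    ∃ (l : List QTy) (r : Res), l ≠ [] ∧ All (Derives N) r (l : Multiset QTy) := by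
  obtain ⟨A, r, h⟩ := h
  exact ⟨[A], r, by simp, All.single h⟩

theorem HasQTy.app_lam {M N : Term} {A : QTy} (hN : QTypable N) (h : HasQTy (M.inst N) A) :
    HasQTy (.app (.lam M) N) A := by
  obtain ⟨r, h⟩ := h
  obtain ⟨r', q, -, hM, hq⟩ := h.of_subst (Replaces.inst N)
  obtain ⟨B, p, hp⟩ := hN
  -- The extra type `B` keeps the list nonempty when the bound variable is not used.
  obtain ⟨l, hl⟩ := Quot.exists_rep (B ::ₘ r'.1 0)
  change (l : Multiset QTy) = _ at hl
  have hne : l ≠ [] := by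
    rintro rfl
    exact Multiset.cons_ne_zero hl.symm
  refine ⟨_, l, comap Nat.succ r', p + q, hne, le_rfl, ⟨l, A, hne, rfl, hM.mono ?_⟩, ?_⟩
  · rw [hl]
    conv_lhs => rw [← push_comap_succ r']
    exact push_le_push (Multiset.le_cons_self _ _) le_rfl
  · rw [hl]
    exact .cons hp hq le_rfl

variable {α : Type*}

mutual
  /-- The reducible terms of a simple type. -/
  def STy.Reducible : STy α → Term → Prop
    | .atom _, M => QTypable M
    | .arrow A B, M => ∀ N, A.Reducible N → B.Reducible (.app M N)
  /-- The reducible terms of a type. -/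
  def Ty.Reducible : Ty α → Term → Prop
    | .simple A, M => A.Reducible M
    | .inter A B, M => A.Reducible M ∧ B.Reducible M
end

mutual
  -- Terms having every quantitative type, such as variables, play the role of neutral terms.
  -- Closure under expansion is needed only at simple types, since the right of an arrow is simple.
  theorem STy.reducible_spec (A : STy α) :
      (∀ M, A.Reducible M → QTypable M) ∧ (∀ M, (∀ C, HasQTy M C) → A.Reducible M) ∧
      ∀ M M', (∀ C, HasQTy M' C → HasQTy M C) → A.Reducible M' → A.Reducible M := by
    cases A with
    | atom a =>
      refine ⟨fun M h => ?_, fun M h => ?_, fun M M' hM h => ?_⟩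
      · simpa only [STy.Reducible] using h
      · simp only [STy.Reducible]
        exact ⟨.atom, h _⟩
      · simp only [STy.Reducible] at h ⊢
        exact h.imp hM
    | arrow A B =>
      have hA := A.reducible_spec
      have hB := B.reducible_spec
      simp only [STy.Reducible]
      refine ⟨fun M h => ?_, fun M h N hN => ?_, fun M M' hM h N hN => ?_⟩
      -- A type of `M` applied to a variable contains an arrow type of `M`.
      · obtain ⟨C, _, l, r, _, _, _, h, _⟩ := hB.1 _ (h (.var 0) (hA.2 _ fun C =>
          ⟨(fun _ => {C}, 0), Multiset.mem_singleton_self C⟩))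
        exact ⟨_, r, h⟩
      · refine hB.2.1 _ fun C => ?_
        obtain ⟨l, r, hl, hr⟩ := (hA.1 N hN).exists_all
        obtain ⟨q, hq⟩ := h (.arrow l C)
        exact ⟨_, l, q, r, hl, le_rfl, hq, hr⟩
      · refine hB.2.2 _ _ (fun C hC => ?_) (h N hN)
        obtain ⟨_, l, q, r, hl, -, hq, hr⟩ := hC
        obtain ⟨q', hq'⟩ := hM _ ⟨q, hq⟩
        exact ⟨_, l, q', r, hl, le_rfl, hq', hr⟩
  theorem Ty.reducible_spec (A : Ty α) :
      (∀ M, A.Reducible M → QTypable M) ∧ (∀ M, (∀ C, HasQTy M C) → A.Reducible M) := by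
    cases A with
    | simple A =>
      have hA := A.reducible_spec
      simp only [Ty.Reducible]
      exact ⟨hA.1, hA.2.1⟩
    | inter A B =>
      have hA := A.reducible_spec
      have hB := B.reducible_spec
      simp only [Ty.Reducible]
      exact ⟨fun M h => hA.1 M h.1, fun M h => ⟨hA.2.1 M h, hB.2 M h⟩⟩
end

theorem Ty.reducible_var (A : Ty α) (x : ℕ) : A.Reducible (.var x) :=
  A.reducible_spec.2 _ fun C => ⟨(fun _ => {C}, 0), Multiset.mem_singleton_self C⟩

-- Composition of renamings and substitutions

namespace Term

theorem subst_rename (ρ : ℕ → ℕ) (f : ℕ → Term) (M : Term) :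
    (M.rename ρ).subst f = M.subst (f ∘ ρ) := by
  induction M generalizing ρ f with
  | var => rfl
  | lam M ih =>
    simp only [rename, subst, ih]
    congr 2
    funext x
    cases x <;> rfl
  | app M N ihM ihN => simp only [rename, subst, ihM, ihN]

theorem rename_rename (ρ τ : ℕ → ℕ) (M : Term) :
    (M.rename ρ).rename τ = M.rename (τ ∘ ρ) := by
  induction M generalizing ρ τ with
  | var => rfl
  | lam M ih =>
    simp only [rename, ih]
    congr 2
    funext x
    cases x <;> rfl
  | app M N ihM ihN => simp only [rename, ihM, ihN]

theorem rename_subst (ρ : ℕ → ℕ) (f : ℕ → Term) (M : Term) :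
    (M.subst f).rename ρ = M.subst fun x => (f x).rename ρ := by
  induction M generalizing ρ f with
  | var => rfl
  | lam M ih =>
    simp only [rename, subst, ih]
    congr 2
    funext x
    cases x with
    | zero => rfl
    | succ x => simp only [liftMap, shift, rename_rename]; rfl
  | app M N ihM ihN => simp only [rename, subst, ihM, ihN]

theorem subst_subst (f g : ℕ → Term) (M : Term) :
    (M.subst f).subst g = M.subst fun x => (f x).subst g := by
  induction M generalizing f g with
  | var => rfl
  | lam M ih =>
    simp only [subst, ih]
    congr 2
    funext x
    cases x with
    | zero => rfl
    | succ x => simp only [liftMap, shift, subst_rename, rename_subst]; rfl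
  | app M N ihM ihN => simp only [subst, ihM, ihN]

theorem subst_var (M : Term) : M.subst var = M := by
  induction M with
  | var => rfl
  | lam M ih =>
    have : liftMap var = var := by
      funext x
      cases x <;> rfl
    simp only [subst, this, ih]
  | app M N ihM ihN => simp only [subst, ihM, ihN]

/-- The map sending `0` to `N` and `n + 1` to `f n`. -/
def consMap (N : Term) (f : ℕ → Term) : ℕ → Term
  | 0 => N
  | n + 1 => f n

theorem inst_subst_liftMap (f : ℕ → Term) (M N : Term) :
    (M.subst (liftMap f)).inst N = M.subst (consMap N f) := by
  rw [inst, subst_subst]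
  congr 1
  funext x
  cases x with
  | zero => rfl
  | succ x =>
    simp only [liftMap, shift, subst_rename]
    exact subst_var _

end Term

/-- Fundamental lemma, by induction on the derivation; abstraction is the only case that uses
β-expansion. -/
theorem Typing.reducible {Γ : Ctx α} {M : Term} {A : Ty α} (h : Typing Γ M A) {f : ℕ → Term}
    (hf : ∀ x C, Γ x = some C → C.Reducible (f x)) : A.Reducible (M.subst f) := by
  induction h generalizing f with
  | var hx => exact hf _ _ hx
  | app _ _ ihM ihN =>
    have hM := ihM hf
    simp only [Ty.Reducible, STy.Reducible] at hM ⊢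
    exact hM _ (ihN hf)
  | @lam Γ M A B _ ih =>
    simp only [Ty.Reducible, STy.Reducible]
    intro N hN
    refine B.reducible_spec.2.2 _ _ (fun C => HasQTy.app_lam (A.reducible_spec.1 N hN)) ?_
    rw [Term.inst_subst_liftMap]
    have := @ih (Term.consMap N f) (by
      rintro (_ | x) C hC
      · cases hC
        exact hN
      · exact hf x C hC)
    simpa only [Ty.Reducible] using this
  | interLeft _ ih =>
    have := ih hf
    simp only [Ty.Reducible] at this ⊢
    exact this.1
  | interRight _ ih =>
    have := ih hf
    simp only [Ty.Reducible] at this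
    exact this.2
  | interIntro _ _ ihA ihB =>
    have hA := ihA hf
    simp only [Ty.Reducible] at hA ⊢
    exact ⟨hA, ihB hf⟩

/-- The identity substitution is reducible in any context, so the values of `σ` may be typed in
unrelated contexts. -/
theorem Assignable.reducible {M : Term} {A : Ty α} (h : Assignable M A) : A.Reducible M := by
  obtain ⟨Γ, h⟩ := h
  simpa only [Term.subst_var] using h.reducible fun x C _ => C.reducible_var x

end SystemD

/-- The typing hypotheses alone make `σ(t)` reducible, hence strongly normalizing. -/
theorem mainTheorem2 {α : Type*} (Γ : SystemD.Ctx α) (t : SystemD.Term) (B : SystemD.Ty α)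
    (σ : SystemD.Subst) (A : SystemD.Ty α)
    (ht : SystemD.Typing Γ t B) (hΓ : ∀ x ∈ σ.dom, Γ x = some A)
    (hσ : σ.FairOfType A) (htSN : t.SN) (hσSN : σ.SN) :
    (σ.apply t).SN := by
  have h : B.Reducible (σ.apply t) := by
    refine ht.reducible fun x C hC => ?_
    split
    · next hx =>
      obtain rfl : A = C := Option.some.inj ((hΓ x hx).symm.trans hC)
      exact (hσ x hx).reducible
    · exact C.reducible_var x
  obtain ⟨_, _, h⟩ := B.reducible_spec.1 _ h
  exact h.sn
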